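/- Let $V$ be a finite set. For a simple graph $G$ on $V$, a toric chamber of $G$ is a connected component of the complement in the torus $\mathbb{R}^V/\mathbb{Z}^V$ of the union of the toric hyperplanes $\{x : x_i = x_j \text{ mod } 1\}$, $\{i,j\}$ an edge of $G$. A toric poset $P$ on $V$ is a set $c(P)$ that is a toric chamber of at least one graph $G$ on $V$; $P$ is then said to be over $G$. For $S\subseteq V$ let $\pi_S$ be the partition of $V$ whose blocks are $S$ (if nonempty) and the singletons $\{v\}$, $v\notin S$. For a partition $\pi$ of $V$ let $D_\pi^{\mathrm{tor}}$ be the set of $x\in\mathbb{R}^V/\mathbb{Z}^V$ with $x_i=x_j$ whenever $i,j$ lie in the same block, let $\bar F_\pi(P)=\overline{c(P)}\cap D_\pi^{\mathrm{tor}}$, and let $\mathrm{cl}_P(\pi)$ be the join of all partitions $\sigma$ with $\bar F_\sigma(P)=\bar F_\pi(P)$. Let $G/{\sim_\pi}$ be the simple graph on the set of blocks of $\pi$ obtained from $G$ by collapsing every block to a vertex and deleting loops and multiple edges; the torus on the set of blocks is identified with $D_\pi^{\mathrm{tor}}$ in the obvious way. If $P$ is a toric poset over $G$, then a toric poset $Q$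 on the set of blocks of $\pi$ is a quotient of $P$ by $\pi$ if $\pi=\mathrm{cl}_P(\pi)$, $Q$ is over $G/{\sim_\pi}$, and $c(Q)\subseteq \bar F_\pi(P)$ under this identification. A toric morphism is a composition of toric isomorphisms (bijections of vertex sets carrying chamber to chamber), such quotients $V\to V/\pi$, inclusions $V\hookrightarrow V'$ (the new chamber is the preimage of the old one under the coordinate projection), and extensions (identity maps with $c(P')\subseteq c(P)$). For a list $(i_1,\dots,i_m)$ of distinct elements of $V$ write $P|_{\{i_1,\dots,i_m\}}=[(i_1,\dots,i_m)]$ if for every $x\in c(P)$, with coordinates taken in $[0,1)$, some cyclic shift $(j_1,\dots,j_m)$ of the list satisfies $x_{j_1}<\dots<x_{j_m}$; the set $\{i_1,\dots,i_m\}$ is a toric chain of $P$ if this holds for some ordering of it. For $i,j\in V$ the toric interval $[i,j]^{\mathrm{tor}}$ is empty if $i,j$ lie on no common toric chain, and otherwise it is $\{i,j\}\cup\{k : P|_{\{i,j,k\}}=[(i,k,j)]\}$. A set $A\subseteq V$ is a geometric toric antichain of $P$ if $D_{\pi_A}^{\mathrm{tor}}\cap c(P)\neq\varnothing$. **Corollary.**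 Let $P$ be a toric poset over a graph $G$ on $V$, and let $S\subseteq V$ be a toric interval or a geometric toric antichain of $P$. Then contracting $S$ defines a toric morphism: there is a toric poset $Q$ over $G/{\sim_{\pi_S}}$ that is a quotient of $P$ by $\pi_S$, and the collapsing map $V\to V/\pi_S$ is a toric morphism $P\to Q$. -/

import Mathlib

universe u

/-- The torus `ℝ^V / ℤ^V`. -/
abbrev Torus (V : Type*) : Type _ := V → UnitAddCircle

/-- The representative in `[0, 1)` of a point of `ℝ / ℤ`. -/
noncomputable def repIco (t : UnitAddCircle) : ℝ := (AddCircle.equivIco (1 : ℝ) 0 t : ℝ)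

/-- The union of the toric hyperplanes `x_i = x_j (mod 1)`, over the edges `{i, j}` of `G`. -/
def toricArrangement {V : Type*} (G : SimpleGraph V) : Set (Torus V) :=
  {x | ∃ i j, G.Adj i j ∧ x i = x j}

/-- Toric chambers of `G`: the connected components of the complement of the arrangement. -/
def IsToricChamber {V : Type*} (G : SimpleGraph V) (c : Set (Torus V)) : Prop :=
  ∃ x ∈ (toricArrangement G)ᶜ, c = connectedComponentIn (toricArrangement G)ᶜ x

/-- A toric poset on the finite set `V`: a set that is a toric chamber for at least one graph. -/
structure ToricPoset (V : Type*) [Finite V] where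
  chamber : Set (Torus V)
  exists_graph : ∃ G : SimpleGraph V, IsToricChamber G chamber

/-- The flat `D_π` of the torus: coordinates in the same block of `π` agree.
Partitions of `V` are equivalence relations (`Setoid V`); coarser partitions are larger. -/
def toricFlat {V : Type*} (π : Setoid V) : Set (Torus V) :=
  {x | ∀ i j, π i j → x i = x j}

/-- The partition `π_S`, whose only block that may fail to be a singleton is `S`
(the discrete partition if `S` is empty). -/
def blockPartition {V : Type*} (S : Set V) : Setoid V where
  r i j := i = j ∨ (i ∈ S ∧ j ∈ S)
  iseqv :=
    { refl := fun _ => Or.inl rfl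
      symm := by
        rintro i j (h | h)
        · exact Or.inl h.symm
        · exact Or.inr ⟨h.2, h.1⟩
      trans := by
        rintro i j k (rfl | h) (rfl | h')
        · exact Or.inl rfl
        · exact Or.inr h'
        · exact Or.inr h
        · exact Or.inr ⟨h.1, h'.2⟩ }

/-- The graph `G / ∼_π`: every block is collapsed to one vertex, and loops and multiple edges
are removed. -/
def contractGraph {V : Type*} (G : SimpleGraph V) (π : Setoid V) : SimpleGraph (Quotient π) where
  Adj a b := a ≠ b ∧ ∃ i j, G.Adj i j ∧ Quotient.mk π i = a ∧ Quotient.mk π j = b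
  symm := ⟨by
    rintro a b ⟨hab, i, j, hij, hi, hj⟩
    exact ⟨hab.symm, j, i, hij.symm, hj, hi⟩⟩
  loopless := ⟨fun _ h => h.1 rfl⟩

namespace ToricPoset

variable {V : Type*} [Finite V]

/-- `P` is a toric poset over the graph `G`. -/
def IsOver (P : ToricPoset V) (G : SimpleGraph V) : Prop := IsToricChamber G P.chamber

/-- `P|_C = [(i₁, …, iₘ)]`, where `l = [i₁, …, iₘ]` lists the distinct elements of `C`: for every
point of the chamber, some cyclic shift of `l` puts the coordinates, reduced to `[0, 1)`, in
strictly increasing order. -/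
def RestrictsTo (P : ToricPoset V) (l : List V) : Prop :=
  l.Nodup ∧ ∀ x ∈ P.chamber, ∃ l' : List V, l' ~r l ∧
    l'.Pairwise (fun a b => repIco (x a) < repIco (x b))

/-- Toric chains. -/
def IsToricChain (P : ToricPoset V) (C : Set V) : Prop :=
  ∃ l : List V, {i | i ∈ l} = C ∧ P.RestrictsTo l

/-- The toric interval `[i, j]^tor`: empty if `i` and `j` lie on no common toric chain, and
otherwise `i`, `j` and all `k` with `P|_{i,j,k} = [(i, k, j)]`. -/
def toricInterval (P : ToricPoset V) (i j : V) : Set V :=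
  {k | (∃ C, P.IsToricChain C ∧ i ∈ C ∧ j ∈ C) ∧ (k = i ∨ k = j ∨ P.RestrictsTo [i, k, j])}

/-- Geometric toric antichains: the flat of `π_A` meets the open chamber. -/
def IsGeometricToricAntichain (P : ToricPoset V) (A : Set V) : Prop :=
  (toricFlat (blockPartition A) ∩ P.chamber).Nonempty

/-- The intersection of the closed chamber with the flat `D_π`. -/
def closedFace (P : ToricPoset V) (π : Setoid V) : Set (Torus V) :=
  closure P.chamber ∩ toricFlat π

/-- The closure of `π` with respect to `P`: the join of all the partitions whose flat cuts out the
same part of the closed chamber as the flat of `π`. -/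
noncomputable def partitionClosure (P : ToricPoset V) (π : Setoid V) : Setoid V :=
  sSup {σ | P.closedFace σ = P.closedFace π}

/-- `Q` is a quotient of `P` (as a toric poset over `G`) by the partition `π`: the partition is
closed with respect to `P`, and `Q` is a toric poset over `G / ∼_π` whose chamber lies in the
projection of the closed chamber of `P` to `D_π`. Here `y ↦ y ∘ Quotient.mk π` identifies the
torus of `Quotient π` with `D_π`; it inverts the coordinate projections of `D_π` that keep one
coordinate in each block. -/
structure IsQuotient (G : SimpleGraph V) (P : ToricPoset V) (π : Setoid V)
    (Q : ToricPoset (Quotient π)) : Prop where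
  source_over : P.IsOver G
  closed : P.partitionClosure π = π
  target_over : Q.IsOver (contractGraph G π)
  chamber_subset : (fun (y : Torus (Quotient π)) (i : V) => y (Quotient.mk π i)) '' Q.chamber ⊆
    P.closedFace π

end ToricPoset

/-- Toric morphisms: the compositions of toric isomorphisms, quotients, inclusions (adding
vertices but no relations) and extensions (adding relations, that is, shrinking the chamber). -/
inductive IsToricMorphism : {V W : Type u} → [Finite V] → [Finite W] →
    ToricPoset V → ToricPoset W → (V → W) → Prop
  | iso {V W : Type u} [Finite V] [Finite W] (P : ToricPoset V) (Q : ToricPoset W) (e : V ≃ W)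
      (h : (fun (x : Torus V) (w : W) => x (e.symm w)) '' P.chamber = Q.chamber) :
      IsToricMorphism P Q e
  | quotient {V : Type u} [Finite V] (G : SimpleGraph V) (P : ToricPoset V) (π : Setoid V)
      (Q : ToricPoset (Quotient π)) (h : ToricPoset.IsQuotient G P π Q) :
      IsToricMorphism P Q (Quotient.mk π)
  | inclusion {V W : Type u} [Finite V] [Finite W] (P : ToricPoset V) (Q : ToricPoset W)
      (f : V → W) (hf : Function.Injective f)
      (h : Q.chamber = {x : Torus W | (fun v => x (f v)) ∈ P.chamber}) :
      IsToricMorphism P Q f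
  | extension {V : Type u} [Finite V] (P Q : ToricPoset V) (h : Q.chamber ⊆ P.chamber) :
      IsToricMorphism P Q id
  | comp {U V W : Type u} [Finite U] [Finite V] [Finite W] (P : ToricPoset U) (Q : ToricPoset V)
      (R : ToricPoset W) (f : U → V) (g : V → W) (hf : IsToricMorphism P Q f)
      (hg : IsToricMorphism Q R g) : IsToricMorphism P R (g ∘ f)

/-! Everything is lifted to `ℝ^V`. A chamber is the image of an alcove, the convex set on which each
edge difference `x_a - x_b` lies strictly between two fixed consecutive integers
(`connectedComponentIn_eq_image_alcove`); points of the closed alcove map into the closed chamber.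

The problem then becomes one of finding a single good point: if a point of the closed alcove
projects to the flat of `π` and is strict on every edge between different blocks, the chamber of the
contracted graph through it lies in the closed face, and because this chamber is open in the flat,
`π` is closed (`exists_isQuotient_of_mem_closedAlcove`). The collapsing map is then a toric morphism
of one step.

For a geometric antichain, a point of the open chamber on the flat is already good. For an interval
`[i, j]`, lying on a common chain confines `x_j - x_i` to some `(m, m + 1)`, even if `i` and `j` are
not adjacent. Let `F` be the part of the closed alcove where `x_j - x_i = m`. On `F` the arc from
`i` to `j` has length zero, so all vertices of the interval coincide. Conversely, a vertex outside
the interval leaves the closed arc at some point of the alcove; shrinking the arc there by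
`collapseArc` gives a point of `F` strict on all edges at that vertex. Since `F` is convex,
averaging these points makes all required edges strict at once. -/

open Set Filter Topology

/-! ### Points of the torus and their lifts -/

theorem unitAddCircle_coe_eq_iff {a b : ℝ} :
    (a : UnitAddCircle) = b ↔ ∃ n : ℤ, a - b = n := by
  rw [← sub_eq_zero, ← AddCircle.coe_sub, AddCircle.coe_eq_zero_iff]
  simp [eq_comm]

theorem repIco_coe (a : ℝ) : repIco (a : UnitAddCircle) = Int.fract a := by
  simp [repIco, AddCircle.coe_equivIco_mk_apply]

theorem not_exists_int_eq_of_between {t : ℝ} {n : ℤ} (h₁ : (n : ℝ) < t) (h₂ : t < n + 1) :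
    ¬ ∃ k : ℤ, t = k := by
  rintro ⟨k, rfl⟩
  have h₃ : n < k := by exact_mod_cast h₁
  have h₄ : k < n + 1 := by exact_mod_cast h₂
  omega

/-- The covering map from `ℝ^V` to the torus. -/
noncomputable def torusProj {V : Type*} (x : V → ℝ) : Torus V := fun v => (x v : UnitAddCircle)

theorem torusProj_surjective {V : Type*} (y : Torus V) : ∃ x : V → ℝ, torusProj x = y := by
  choose x hx using fun v => QuotientAddGroup.mk_surjective (y v)
  exact ⟨x, funext hx⟩

theorem continuous_torusProj {V : Type*} : Continuous (torusProj (V := V)) :=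
  continuous_pi fun v => (AddCircle.continuous_mk' (1 : ℝ)).comp (continuous_apply v)

theorem isOpenMap_torusProj {V : Type*} [Finite V] : IsOpenMap (torusProj (V := V)) :=
  IsOpenMap.piMap (f := fun (_ : V) (t : ℝ) => (t : UnitAddCircle))
    (fun _ => QuotientAddGroup.isOpenMap_coe)
    (Eventually.of_forall fun _ => QuotientAddGroup.mk_surjective)

theorem torusProj_eq_iff {V : Type*} {x y : V → ℝ} :
    torusProj x = torusProj y ↔ ∃ n : V → ℤ, ∀ v, x v - y v = n v := by
  rw [← Classical.skolem (p := fun v (n : ℤ) => x v - y v = n)]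
  simp only [funext_iff, torusProj, unitAddCircle_coe_eq_iff]

/-! ### Alcoves: the lifts of toric chambers -/

/-- The region of the arrangement of affine hyperplanes `x_a - x_b ∈ ℤ`, over the edges `{a, b}`
of `G`, that contains `x₀`. -/
def alcove {V : Type*} (G : SimpleGraph V) (x₀ : V → ℝ) : Set (V → ℝ) :=
  {z | ∀ a b, G.Adj a b → (⌊x₀ a - x₀ b⌋ : ℝ) < z a - z b ∧ z a - z b < ⌊x₀ a - x₀ b⌋ + 1}

/-- The closed version of `alcove`. -/
def closedAlcove {V : Type*} (G : SimpleGraph V) (x₀ : V → ℝ) : Set (V → ℝ) :=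
  {z | ∀ a b, G.Adj a b → (⌊x₀ a - x₀ b⌋ : ℝ) ≤ z a - z b ∧ z a - z b ≤ ⌊x₀ a - x₀ b⌋ + 1}

section alcove

variable {V : Type*} {G : SimpleGraph V} {x₀ : V → ℝ}

theorem floor_eq_of_mem_alcove {z : V → ℝ} (hz : z ∈ alcove G x₀) {a b : V} (h : G.Adj a b) :
    ⌊z a - z b⌋ = ⌊x₀ a - x₀ b⌋ :=
  Int.floor_eq_iff.2 ⟨(hz a b h).1.le, (hz a b h).2⟩

theorem alcove_eq_of_mem {z : V → ℝ} (hz : z ∈ alcove G x₀) : alcove G z = alcove G x₀ := by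
  ext y
  refine forall_congr' fun a => forall_congr' fun b => forall_congr' fun h => ?_
  rw [floor_eq_of_mem_alcove hz h]

theorem self_mem_alcove (h : torusProj x₀ ∈ (toricArrangement G)ᶜ) : x₀ ∈ alcove G x₀ := by
  intro a b hab
  refine ⟨lt_of_le_of_ne (Int.floor_le _) fun h' => h ⟨a, b, hab, ?_⟩, Int.lt_floor_add_one _⟩
  exact unitAddCircle_coe_eq_iff.2 ⟨_, h'.symm⟩

theorem torusProj_mem_of_mem_alcove {z : V → ℝ} (hz : z ∈ alcove G x₀) :
    torusProj z ∈ (toricArrangement G)ᶜ := by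
  rintro ⟨a, b, hab, h⟩
  exact not_exists_int_eq_of_between (hz a b hab).1 (hz a b hab).2 (unitAddCircle_coe_eq_iff.1 h)

theorem alcove_subset_closedAlcove : alcove G x₀ ⊆ closedAlcove G x₀ :=
  fun _ hz a b h => ⟨(hz a b h).1.le, (hz a b h).2.le⟩

/-- A convex combination of weak and strict inequalities is strict as soon as the strict one has
positive weight. This gives both the connectedness of the alcove and its density in the closed
alcove. -/
theorem lineMap_mem_alcove {p q : V → ℝ} (hp : p ∈ closedAlcove G x₀) (hq : q ∈ alcove G x₀)
    {t : ℝ} (h₀ : 0 < t) (h₁ : t ≤ 1) : (fun v => p v + t * (q v - p v)) ∈ alcove G x₀ := by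
  intro a b h
  obtain ⟨h1, h2⟩ := hp a b h
  obtain ⟨h3, h4⟩ := hq a b h
  have e : p a + t * (q a - p a) - (p b + t * (q b - p b)) =
      (1 - t) * (p a - p b) + t * (q a - q b) := by ring
  have h5 : (0 : ℝ) ≤ 1 - t := by linarith
  have h6 := mul_le_mul_of_nonneg_left h1 h5
  have h7 := mul_le_mul_of_nonneg_left h2 h5
  have h8 := mul_lt_mul_of_pos_left h3 h₀
  have h9 := mul_lt_mul_of_pos_left h4 h₀
  simp only [e]
  constructor <;> linarith

theorem isPreconnected_alcove : IsPreconnected (alcove G x₀) := by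
  rcases (alcove G x₀).eq_empty_or_nonempty with h | ⟨q, hq⟩
  · rw [h]; exact isPreconnected_empty
  refine isPreconnected_of_forall q fun p hp =>
    ⟨(fun (t : ℝ) v => p v + t * (q v - p v)) '' Icc 0 1, ?_, ⟨1, by simp, by simp⟩,
      ⟨0, by simp, by simp⟩, isPreconnected_Icc.image _ (by fun_prop)⟩
  rintro _ ⟨t, ht, rfl⟩
  rcases ht.1.eq_or_lt with rfl | h
  · simpa using hp
  · exact lineMap_mem_alcove (alcove_subset_closedAlcove hp) hq h ht.2

theorem closedAlcove_subset_closure (h : (alcove G x₀).Nonempty) :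
    closedAlcove G x₀ ⊆ closure (alcove G x₀) := by
  obtain ⟨q, hq⟩ := h
  intro p hp
  have hc : Continuous fun (t : ℝ) v => p v + t * (q v - p v) := by fun_prop
  have ht : Tendsto (fun (t : ℝ) v => p v + t * (q v - p v)) (𝓝[>] 0) (𝓝 p) := by
    simpa using (hc.tendsto 0).mono_left (nhdsWithin_le_nhds (s := Ioi 0))
  refine mem_closure_of_tendsto ht ?_
  filter_upwards [Ioo_mem_nhdsGT (zero_lt_one' ℝ)] with t ht
  exact lineMap_mem_alcove hp hq ht.1 ht.2.le

theorem isOpen_alcove [Finite V] : IsOpen (alcove G x₀) := by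
  have e : alcove G x₀ = ⋂ a, ⋂ b, ⋂ (_ : G.Adj a b), (fun z : V → ℝ => z a - z b) ⁻¹'
      Ioo (⌊x₀ a - x₀ b⌋ : ℝ) (⌊x₀ a - x₀ b⌋ + 1) := by
    ext
    simp [alcove]
  rw [e]
  exact isOpen_iInter_of_finite fun a => isOpen_iInter_of_finite fun b =>
    isOpen_iInter_of_finite fun _ => isOpen_Ioo.preimage (by fun_prop)

/-- Openness in the form used below: a single coordinate can be nudged independently of the others.
-/
theorem exists_update_mem_alcove [Finite V] [DecidableEq V] {z : V → ℝ} (hz : z ∈ alcove G x₀)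
    (a : V) :
    ∃ ε > 0, ∀ t : ℝ, |t| < ε → Function.update z a (z a + t) ∈ alcove G x₀ := by
  have hc : Continuous fun t : ℝ => Function.update z a (z a + t) := by fun_prop
  have h := hc.continuousAt (x := 0) (isOpen_alcove.mem_nhds (by simpa using hz))
  obtain ⟨ε, hε, h⟩ := Metric.mem_nhds_iff.1 h
  exact ⟨ε, hε, fun t ht => h (by simpa using ht)⟩

/-- Sharing an alcove, for suitable lifts, is a symmetric and transitive relation that holds
locally, so it holds throughout a connected set. Conversely the image of an alcove is connected and
avoids the arrangement. -/
theorem connectedComponentIn_eq_image_alcove [Finite V]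
    (h : torusProj x₀ ∈ (toricArrangement G)ᶜ) :
    connectedComponentIn (toricArrangement G)ᶜ (torusProj x₀) = torusProj '' alcove G x₀ := by
  apply subset_antisymm
  · intro y hy
    have key := isPreconnected_connectedComponentIn.induction₂
      (s := connectedComponentIn (toricArrangement G)ᶜ (torusProj x₀))
      (fun x y => ∃ x' y', torusProj x' = x ∧ torusProj y' = y ∧ y' ∈ alcove G x')
      ?_ ?_ ?_ (mem_connectedComponentIn h) hy
    · obtain ⟨x', y', hx', rfl, hxy⟩ := key
      obtain ⟨n, hn⟩ := torusProj_eq_iff.1 hx'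
      -- The lift `x'` of the base point may differ from `x₀` by an integer vector, and translating
      -- by it carries one alcove to the other.
      refine ⟨fun v => y' v - n v, fun a b hab => ?_, ?_⟩
      · have e : x₀ a - x₀ b = x' a - x' b - ((n a - n b : ℤ) : ℝ) := by
          push_cast
          linarith [hn a, hn b]
        obtain ⟨h1, h2⟩ := hxy a b hab
        rw [e, Int.floor_sub_intCast]
        push_cast
        constructor <;> linarith
      · exact torusProj_eq_iff.2 ⟨fun v => -n v, fun v => by push_cast; ring⟩
    · intro x hx
      have hx := connectedComponentIn_subset _ _ hx
      obtain ⟨x', rfl⟩ := torusProj_surjective x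
      have hU : torusProj '' alcove G x' ∈ 𝓝 (torusProj x') :=
        (isOpenMap_torusProj _ isOpen_alcove).mem_nhds ⟨x', self_mem_alcove hx, rfl⟩
      filter_upwards [mem_nhdsWithin_of_mem_nhds hU] with y ⟨y', hy', e⟩
      exact ⟨x', y', rfl, e, hy'⟩
    · rintro x y z - - - ⟨x', y', hx, hy, hxy⟩ ⟨y'', z', hy', hz, hyz⟩
      obtain ⟨n, hn⟩ := torusProj_eq_iff.1 (hy.trans hy'.symm)
      refine ⟨x', fun v => z' v + n v, hx, ?_, fun a b hab => ?_⟩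
      · rw [← hz]
        exact torusProj_eq_iff.2 ⟨n, fun v => by ring⟩
      · have e : y'' a - y'' b = y' a - y' b - ((n a - n b : ℤ) : ℝ) := by
          push_cast
          linarith [hn a, hn b]
        have := hyz a b hab
        rw [e, Int.floor_sub_intCast, floor_eq_of_mem_alcove hxy hab] at this
        push_cast at this
        constructor <;> linarith
    · rintro x y hx - ⟨x', y', rfl, rfl, hxy⟩
      refine ⟨y', x', rfl, rfl, ?_⟩
      rw [alcove_eq_of_mem hxy]
      exact self_mem_alcove (connectedComponentIn_subset _ _ hx)
  · refine (isPreconnected_alcove.image _ continuous_torusProj.continuousOn).subset_connectedComponentIn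
      ⟨x₀, self_mem_alcove h, rfl⟩ ?_
    rintro _ ⟨z, hz, rfl⟩
    exact torusProj_mem_of_mem_alcove hz

theorem IsToricChamber.exists_eq_image_alcove [Finite V] {c : Set (Torus V)}
    (hc : IsToricChamber G c) :
    ∃ x₀, torusProj x₀ ∈ (toricArrangement G)ᶜ ∧ c = torusProj '' alcove G x₀ := by
  obtain ⟨x, hx, rfl⟩ := hc
  obtain ⟨x₀, rfl⟩ := torusProj_surjective x
  exact ⟨x₀, hx, connectedComponentIn_eq_image_alcove hx⟩

/-- A coordinate difference that is never an integer on an alcove has constant integer part. -/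
theorem exists_int_between_of_forall_ne (h₀ : x₀ ∈ alcove G x₀) {a b : V}
    (h : ∀ z ∈ alcove G x₀, ¬ ∃ k : ℤ, z a - z b = k) :
    ∃ m : ℤ, ∀ z ∈ alcove G x₀, (m : ℝ) < z a - z b ∧ z a - z b < m + 1 := by
  have hI : ((fun z : V → ℝ => z a - z b) '' alcove G x₀).OrdConnected :=
    (isPreconnected_alcove.image _ (by fun_prop)).ordConnected
  refine ⟨⌊x₀ a - x₀ b⌋, fun z hz => ⟨?_, ?_⟩⟩ <;> by_contra! hlt
  · obtain ⟨y, hy, e⟩ := hI.out ⟨z, hz, rfl⟩ ⟨x₀, h₀, rfl⟩ ⟨hlt, Int.floor_le _⟩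
    exact h y hy ⟨_, e⟩
  · obtain ⟨y, hy, e⟩ := hI.out ⟨x₀, h₀, rfl⟩ ⟨z, hz, rfl⟩
      (⟨(Int.lt_floor_add_one _).le, hlt⟩ : (⌊x₀ a - x₀ b⌋ : ℝ) + 1 ∈ Icc _ _)
    exact h y hy ⟨⌊x₀ a - x₀ b⌋ + 1, by push_cast; exact e⟩

end alcove

/-! ### Quotients from points of the closed alcove -/

/-- A point of the closed alcove whose image lies on the flat of `π`, and which lies on none of the
hyperplanes of edges between different blocks, yields a quotient by `π`. -/
theorem exists_isQuotient_of_mem_closedAlcove {V : Type*} [Finite V] {G : SimpleGraph V}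
    {P : ToricPoset V} (hP : P.IsOver G) {x₀ : V → ℝ} (h₀ : x₀ ∈ alcove G x₀)
    (hc : P.chamber = torusProj '' alcove G x₀) (π : Setoid V) {x : V → ℝ}
    (hx : x ∈ closedAlcove G x₀) (hflat : torusProj x ∈ toricFlat π)
    (hstrict : ∀ a b, G.Adj a b → ¬ π a b →
      (⌊x₀ a - x₀ b⌋ : ℝ) < x a - x b ∧ x a - x b < ⌊x₀ a - x₀ b⌋ + 1) :
    ∃ Q, ToricPoset.IsQuotient G P π Q := by
  classical
  set y : Quotient π → ℝ := fun c => x c.out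
  have hyx : ∀ v, torusProj y (Quotient.mk π v) = torusProj x v := fun v =>
    hflat _ _ (Quotient.mk_out (s := π) v)
  have hyc : torusProj y ∈ (toricArrangement (contractGraph G π))ᶜ := by
    rintro ⟨_, _, ⟨hne, i, j, hij, rfl, rfl⟩, h⟩
    rw [hyx, hyx] at h
    obtain ⟨h1, h2⟩ := hstrict i j hij fun h => hne (Quotient.sound h)
    exact not_exists_int_eq_of_between h1 h2 (unitAddCircle_coe_eq_iff.1 h)
  have hQ : IsToricChamber (contractGraph G π) (torusProj '' alcove (contractGraph G π) y) :=
    ⟨_, hyc, (connectedComponentIn_eq_image_alcove hyc).symm⟩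
  -- `y` copies one representative per block, so it agrees with `x` only modulo integers; `n`
  -- records the discrepancy and moves lifts back to the closed alcove of `x₀`.
  choose n hn using fun v => unitAddCircle_coe_eq_iff.1 (hyx v)
  have hsub : ∀ z ∈ alcove (contractGraph G π) y,
      (fun v => torusProj z (Quotient.mk π v)) ∈ P.closedFace π := by
    intro z hz
    refine ⟨?_, fun i j hij => congrArg (torusProj z) (Quotient.sound hij)⟩
    have hmem : (fun v => z (Quotient.mk π v) - n v) ∈ closedAlcove G x₀ := by
      intro a b hab
      by_cases hπ : π a b
      · have e : Quotient.mk π a = Quotient.mk π b := Quotient.sound hπ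
        have h1 := hn a
        rw [e] at h1
        have h2 := hn b
        have h3 := hx a b hab
        simp only [e]
        constructor <;> linarith
      · have hadj : (contractGraph G π).Adj (Quotient.mk π a) (Quotient.mk π b) :=
          ⟨fun h => hπ (Quotient.exact h), a, b, hab, rfl, rfl⟩
        obtain ⟨h1, h2⟩ := hz _ _ hadj
        obtain ⟨h3, h4⟩ := hstrict a b hab hπ
        have e : y (Quotient.mk π a) - y (Quotient.mk π b) =
            x a - x b + ((n a - n b : ℤ) : ℝ) := by
          push_cast
          linarith [hn a, hn b]
        have hf : ⌊x a - x b⌋ = ⌊x₀ a - x₀ b⌋ := Int.floor_eq_iff.2 ⟨h3.le, h4⟩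
        rw [e, Int.floor_add_intCast, hf] at h1 h2
        push_cast at h1 h2
        constructor <;> linarith
    have hcl : torusProj (fun v => z (Quotient.mk π v) - n v) ∈ closure P.chamber := by
      rw [hc]
      exact image_closure_subset_closure_image continuous_torusProj
        ⟨_, closedAlcove_subset_closure ⟨x₀, h₀⟩ hmem, rfl⟩
    convert hcl using 1
    funext v
    exact unitAddCircle_coe_eq_iff.2 ⟨n v, by ring⟩
  refine ⟨⟨_, _, hQ⟩, hP, le_antisymm (sSup_le fun σ hσ => ?_) (le_sSup rfl), hQ, ?_⟩
  · intro a b hab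
    by_contra hπ
    have hne : Quotient.mk π a ≠ Quotient.mk π b := fun h => hπ (Quotient.exact h)
    have heq : ∀ z ∈ alcove (contractGraph G π) y,
        torusProj z (Quotient.mk π a) = torusProj z (Quotient.mk π b) := by
      intro z hz
      have h := hsub z hz
      rw [← show P.closedFace σ = P.closedFace π from hσ] at h
      exact h.2 a b hab
    have hy' := self_mem_alcove hyc
    -- A coarser identification of the blocks of `a` and `b` would survive moving the first alone by
    -- `t`; with `0 < t < 1` that would make `t` an integer.
    obtain ⟨ε, hε, h⟩ := exists_update_mem_alcove hy' (Quotient.mk π a)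
    obtain ⟨t, ht, hlt⟩ := exists_between (lt_min hε one_pos)
    obtain ⟨ht₂, ht₁⟩ := lt_min_iff.1 hlt
    have h1 := heq _ hy'
    have h2 := heq _ (h t (by rwa [abs_of_pos ht]))
    have e : torusProj (Function.update y (Quotient.mk π a) (y (Quotient.mk π a) + t))
        (Quotient.mk π b) = torusProj y (Quotient.mk π b) := by
      simp [torusProj, Function.update_of_ne hne.symm]
    rw [e, ← h1] at h2
    simp only [torusProj, Function.update_self] at h2
    refine not_exists_int_eq_of_between (n := 0) (t := t) (by simpa) (by simpa) ?_
    simpa using unitAddCircle_coe_eq_iff.1 h2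
  · rintro _ ⟨_, ⟨z, hz, rfl⟩, rfl⟩
    exact hsub z hz


/-! ### Collapsing an arc -/

/-- A monotone map of degree one that collapses `[α, α + d] + ℤ` and is injective elsewhere. -/
noncomputable def collapseArc (α d t : ℝ) : ℝ := ⌊t - α⌋ + max (Int.fract (t - α)) d

theorem collapseArc_add_intCast (α d t : ℝ) (n : ℤ) :
    collapseArc α d (t + n) = collapseArc α d t + n := by
  have e : t + n - α = t - α + n := by ring
  simp only [collapseArc, e, Int.floor_add_intCast, Int.fract_add_intCast]
  push_cast
  ring

theorem collapseArc_monotone (α : ℝ) {d : ℝ} (hd : d < 1) : Monotone (collapseArc α d) := by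
  intro s t hst
  have h : s - α ≤ t - α := by linarith
  rcases (Int.floor_mono h).eq_or_lt with h' | h'
  · simp only [collapseArc, Int.fract, h']
    gcongr
  · have h'' : (⌊s - α⌋ : ℝ) + 1 ≤ ⌊t - α⌋ := by exact_mod_cast h'
    have h1 : max (Int.fract (s - α)) d ≤ 1 := max_le (Int.fract_lt_one _).le hd.le
    have h2 : 0 ≤ max (Int.fract (t - α)) d := (Int.fract_nonneg _).trans (le_max_left _ _)
    simp only [collapseArc]
    linarith

/-- One of the two points being off the collapsed arc is enough: with equal floors the larger point
is then off it too, and with different floors `d < 1` keeps the values apart. -/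
theorem collapseArc_lt {α d s t : ℝ} (hd : d < 1) (hst : s < t)
    (h : d < Int.fract (s - α) ∨ d < Int.fract (t - α)) :
    collapseArc α d s < collapseArc α d t := by
  have hle : s - α < t - α := by linarith
  rcases (Int.floor_mono hle.le).eq_or_lt with h' | h'
  · have hf : Int.fract (s - α) < Int.fract (t - α) := by
      simp only [Int.fract, h']
      linarith
    have hdt : d < Int.fract (t - α) := h.elim (fun h => h.trans hf) id
    simp only [collapseArc, h', max_eq_left hdt.le]
    linarith [max_lt hf hdt]
  · have h'' : (⌊s - α⌋ : ℝ) + 1 ≤ ⌊t - α⌋ := by exact_mod_cast h'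
    have h1 : max (Int.fract (s - α)) d < 1 := max_lt (Int.fract_lt_one _) hd
    have h2 : 0 ≤ max (Int.fract (t - α)) d := (Int.fract_nonneg _).trans (le_max_left _ _)
    simp only [collapseArc]
    linarith

theorem collapseArc_self {α d : ℝ} (hd : 0 ≤ d) : collapseArc α d α = d := by
  simp [collapseArc, hd]

theorem collapseArc_right {α d : ℝ} (h₀ : 0 ≤ d) (h₁ : d < 1) : collapseArc α d (α + d) = d := by
  have hf : Int.fract d = d := Int.fract_eq_self.2 ⟨h₀, h₁⟩
  have hfl : ⌊d⌋ = 0 := Int.floor_eq_zero_iff.2 ⟨h₀, h₁⟩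
  simp [collapseArc, hf, hfl]

section alcove

variable {V : Type*} {G : SimpleGraph V} {x₀ : V → ℝ}

/-- The alcove inequalities compare `q a` with integer translates of `q b`, and a monotone map
commuting with integer translations preserves such comparisons weakly. -/
theorem collapseArc_comp_mem_closedAlcove (α : ℝ) {d : ℝ} (hd : d < 1) {q : V → ℝ}
    (hq : q ∈ alcove G x₀) : (fun v => collapseArc α d (q v)) ∈ closedAlcove G x₀ := by
  intro a b hab
  obtain ⟨h1, h2⟩ := hq a b hab
  have h3 := collapseArc_monotone α hd (show q b + (⌊x₀ a - x₀ b⌋ : ℤ) ≤ q a by linarith)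
  have h4 := collapseArc_monotone α hd
    (show q a ≤ q b + (⌊x₀ a - x₀ b⌋ + 1 : ℤ) by push_cast; linarith)
  rw [collapseArc_add_intCast] at h3 h4
  push_cast at h4
  constructor <;> linarith

theorem collapseArc_comp_strict {α d : ℝ} (hd : d < 1) {q : V → ℝ} (hq : q ∈ alcove G x₀)
    {a b : V} (hab : G.Adj a b) (h : d < Int.fract (q a - α) ∨ d < Int.fract (q b - α)) :
    (⌊x₀ a - x₀ b⌋ : ℝ) < collapseArc α d (q a) - collapseArc α d (q b) ∧
      collapseArc α d (q a) - collapseArc α d (q b) < ⌊x₀ a - x₀ b⌋ + 1 := by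
  obtain ⟨h1, h2⟩ := hq a b hab
  have hfr : ∀ n : ℤ, Int.fract (q b + n - α) = Int.fract (q b - α) := fun n => by
    rw [show q b + n - α = q b - α + n by ring, Int.fract_add_intCast]
  have h3 := collapseArc_lt hd (show q b + (⌊x₀ a - x₀ b⌋ : ℤ) < q a by linarith)
    (by rw [hfr]; exact h.symm)
  have h4 := collapseArc_lt hd
    (show q a < q b + (⌊x₀ a - x₀ b⌋ + 1 : ℤ) by push_cast; linarith)
    (by rw [hfr]; exact h)
  rw [collapseArc_add_intCast] at h3 h4
  push_cast at h4
  constructor <;> linarith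

/-- If `F` is a convex set of points of the closed alcove, and every edge in a finite set is strict
at some point of `F`, then all these edges are strict at a common point of `F`. -/
theorem exists_mem_forall_strict {F : Set (V → ℝ)} (hF : Convex ℝ F) (hne : F.Nonempty)
    (hsub : F ⊆ closedAlcove G x₀) (E : Finset (V × V)) (hE : ∀ e ∈ E, G.Adj e.1 e.2)
    (h : ∀ e ∈ E, ∃ x ∈ F, (⌊x₀ e.1 - x₀ e.2⌋ : ℝ) < x e.1 - x e.2 ∧
      x e.1 - x e.2 < ⌊x₀ e.1 - x₀ e.2⌋ + 1) :
    ∃ x ∈ F, ∀ e ∈ E, (⌊x₀ e.1 - x₀ e.2⌋ : ℝ) < x e.1 - x e.2 ∧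
      x e.1 - x e.2 < ⌊x₀ e.1 - x₀ e.2⌋ + 1 := by
  classical
  induction E using Finset.induction_on with
  | empty => exact ⟨_, hne.some_mem, by simp⟩
  | insert e E _ ih =>
    obtain ⟨x, hx, hxE⟩ := ih (fun e he => hE e (Finset.mem_insert_of_mem he))
      (fun e he => h e (Finset.mem_insert_of_mem he))
    obtain ⟨y, hy, hye⟩ := h e (Finset.mem_insert_self _ _)
    refine ⟨(1 / 2 : ℝ) • x + (1 / 2 : ℝ) • y,
      hF hx hy (by norm_num) (by norm_num) (by norm_num), fun f hf => ?_⟩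
    have hxf := hsub hx _ _ (hE f hf)
    have hyf := hsub hy _ _ (hE f hf)
    simp only [Pi.add_apply, Pi.smul_apply, smul_eq_mul]
    rcases Finset.mem_insert.1 hf with rfl | hf
    · constructor <;> linarith
    · have := hxE f hf
      constructor <;> linarith

theorem convex_closedAlcove : Convex ℝ (closedAlcove G x₀) := by
  intro x hx y hy s t hs ht hst a b hab
  obtain ⟨h1, h2⟩ := hx a b hab
  obtain ⟨h3, h4⟩ := hy a b hab
  have h5 := mul_le_mul_of_nonneg_left h1 hs
  have h6 := mul_le_mul_of_nonneg_left h2 hs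
  have h7 := mul_le_mul_of_nonneg_left h3 ht
  have h8 := mul_le_mul_of_nonneg_left h4 ht
  obtain rfl : t = 1 - s := by linarith
  simp only [Pi.add_apply, Pi.smul_apply, smul_eq_mul]
  constructor <;> linarith

/-- A coordinate difference bounded on an alcove has the same bound on the closed alcove. -/
theorem sub_le_of_mem_closedAlcove (h₀ : x₀ ∈ alcove G x₀) {a b : V} {r : ℝ}
    (h : ∀ z ∈ alcove G x₀, z a - z b ≤ r) {x : V → ℝ} (hx : x ∈ closedAlcove G x₀) :
    x a - x b ≤ r := by
  have hcl : IsClosed {z : V → ℝ | z a - z b ≤ r} := isClosed_le (by fun_prop) continuous_const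
  exact closure_minimal h hcl (closedAlcove_subset_closure ⟨x₀, h₀⟩ hx)

end alcove

/-! ### Toric intervals -/

theorem List.isRotated_triple_iff {α : Type*} {a b c : α} {l : List α} :
    l ~r [a, b, c] ↔ l = [a, b, c] ∨ l = [b, c, a] ∨ l = [c, a, b] := by
  rw [List.isRotated_comm, List.isRotated_iff_mem_map_range]
  simp [List.range_succ]
  tauto

/-- Cyclic order of three points of the circle in terms of their lifts. -/
theorem exists_isRotated_pairwise_repIco_iff {V : Type*} {x : V → ℝ} {a b c : V} :
    (∃ l : List V, l ~r [a, b, c] ∧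
      l.Pairwise (fun v w => repIco (torusProj x v) < repIco (torusProj x w))) ↔
    ∃ m n : ℤ, x a < x b + m ∧ x b + m < x c + n ∧ x c + n < x a + 1 := by
  have ha := Int.floor_add_fract (x a)
  have hb := Int.floor_add_fract (x b)
  have hc := Int.floor_add_fract (x c)
  have ha₀ := Int.fract_nonneg (x a)
  have hb₀ := Int.fract_nonneg (x b)
  have hc₀ := Int.fract_nonneg (x c)
  have ha₁ := Int.fract_lt_one (x a)
  have hb₁ := Int.fract_lt_one (x b)
  have hc₁ := Int.fract_lt_one (x c)
  simp only [List.isRotated_triple_iff, torusProj, repIco_coe]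
  constructor
  · rintro ⟨l, rfl | rfl | rfl, h⟩ <;> simp at h <;> obtain ⟨⟨h1, h2⟩, h3⟩ := h
    · refine ⟨⌊x a⌋ - ⌊x b⌋, ⌊x a⌋ - ⌊x c⌋, ?_, ?_, ?_⟩ <;> push_cast <;> linarith
    · refine ⟨⌊x a⌋ - ⌊x b⌋ + 1, ⌊x a⌋ - ⌊x c⌋ + 1, ?_, ?_, ?_⟩ <;> push_cast <;> linarith
    · refine ⟨⌊x a⌋ - ⌊x b⌋, ⌊x a⌋ - ⌊x c⌋ + 1, ?_, ?_, ?_⟩ <;> push_cast <;> linarith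
  · rintro ⟨m, n, h1, h2, h3⟩
    have floor_b : ∀ k : ℤ, (k : ℝ) ≤ x b + m → x b + m < k + 1 → (⌊x b⌋ : ℝ) = k - m := by
      intro k hk hk'
      have : ⌊x b⌋ = k - m := Int.floor_eq_iff.2 (by push_cast; constructor <;> linarith)
      rw [this]; push_cast; rfl
    have floor_c : ∀ k : ℤ, (k : ℝ) ≤ x c + n → x c + n < k + 1 → (⌊x c⌋ : ℝ) = k - n := by
      intro k hk hk'
      have : ⌊x c⌋ = k - n := Int.floor_eq_iff.2 (by push_cast; constructor <;> linarith)
      rw [this]; push_cast; rfl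
    -- The three rotations correspond to the position of the integer `⌊x a⌋ + 1`: beyond the lift of
    -- `c`, between those of `b` and `c`, or before that of `b`.
    rcases lt_or_ge (x c + n) (⌊x a⌋ + 1) with hcn | hcn
    · have e1 := floor_b ⌊x a⌋ (by linarith) (by linarith)
      have e2 := floor_c ⌊x a⌋ (by linarith) (by linarith)
      refine ⟨_, Or.inl rfl, ?_⟩
      simp
      refine ⟨⟨?_, ?_⟩, ?_⟩ <;> linarith
    have e2 := floor_c (⌊x a⌋ + 1) (by push_cast; linarith) (by push_cast; linarith)
    push_cast at e2
    rcases lt_or_ge (x b + m) (⌊x a⌋ + 1) with hbm | hbm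
    · have e1 := floor_b ⌊x a⌋ (by linarith) (by linarith)
      refine ⟨_, Or.inr (Or.inr rfl), ?_⟩
      simp
      refine ⟨⟨?_, ?_⟩, ?_⟩ <;> linarith
    · have e1 := floor_b (⌊x a⌋ + 1) (by push_cast; linarith) (by push_cast; linarith)
      push_cast at e1
      refine ⟨_, Or.inr (Or.inl rfl), ?_⟩
      simp
      refine ⟨⟨?_, ?_⟩, ?_⟩ <;> linarith

namespace ToricPoset

variable {V : Type*} [Finite V] {G : SimpleGraph V} {P : ToricPoset V}

theorem IsToricChain.ne_of_mem_chamber {C : Set V} (hC : P.IsToricChain C) {i j : V} (hi : i ∈ C)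
    (hj : j ∈ C) (hij : i ≠ j) {x : Torus V} (hx : x ∈ P.chamber) : x i ≠ x j := by
  obtain ⟨l, rfl, -, h⟩ := hC
  obtain ⟨l', hl, hp⟩ := h x hx
  have hp' : l'.Pairwise (fun a b => x a ≠ x b) :=
    hp.imp fun h e => h.ne (congrArg repIco e)
  have : Std.Symm (fun a b => x a ≠ x b) := ⟨fun _ _ h => h.symm⟩
  exact hp'.forall (hl.mem_iff.2 hi) (hl.mem_iff.2 hj) hij

/-- If at all points of an alcove of the chamber the coordinate of `a` lies, modulo `1`, in the
closed arc from the coordinate of `i` to that of `j`, then `a` lies in the toric interval. -/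
theorem restrictsTo_of_forall_mem_arc {x₀ : V → ℝ} (hc : P.chamber = torusProj '' alcove G x₀)
    {i j a : V} (hij : i ≠ j) (hai : a ≠ i) (haj : a ≠ j) {m : ℤ}
    (hm : ∀ z ∈ alcove G x₀, (m : ℝ) < z j - z i ∧ z j - z i < m + 1)
    (h : ∀ z ∈ alcove G x₀, ∃ n : ℤ, z i ≤ z a + n ∧ z a + n ≤ z j - m) :
    P.RestrictsTo [i, a, j] := by
  classical
  refine ⟨by simp [hij, hai.symm, haj], ?_⟩
  rw [hc]
  rintro _ ⟨z, hz, rfl⟩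
  rw [exists_isRotated_pairwise_repIco_iff]
  obtain ⟨n, hn₁, hn₂⟩ := h z hz
  obtain ⟨hm₁, hm₂⟩ := hm z hz
  obtain ⟨ε, hε, hup⟩ := exists_update_mem_alcove hz a
  have hpos : 0 < 1 - (z j - z i - m) := by linarith
  -- If `a` sat at an end of the arc, pushing it outwards by `t` would leave the arc; `t` is below
  -- the length of the complementary arc, so `a` cannot re-enter at the other end.
  obtain ⟨t, ht, hlt⟩ := exists_between (lt_min hε hpos)
  obtain ⟨ht₁, ht₂⟩ := lt_min_iff.1 hlt
  refine ⟨n, -m, lt_of_le_of_ne hn₁ fun e => ?_, ?_, by push_cast; linarith⟩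
  · obtain ⟨k, hk₁, hk₂⟩ := h _ (hup (-t) (by rwa [abs_neg, abs_of_pos ht]))
    simp only [Function.update_self, Function.update_of_ne hai.symm,
      Function.update_of_ne haj.symm] at hk₁ hk₂
    have h1 : (n : ℝ) < k := by linarith
    have h2 : (k : ℝ) < n + 1 := by linarith
    norm_cast at h1 h2
    omega
  · push_cast
    refine lt_of_le_of_ne (by linarith) fun e => ?_
    obtain ⟨k, hk₁, hk₂⟩ := h _ (hup t (by rwa [abs_of_pos ht]))
    simp only [Function.update_self, Function.update_of_ne hai.symm,
      Function.update_of_ne haj.symm] at hk₁ hk₂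
    have h1 : (n : ℝ) < k + 1 := by linarith
    have h2 : (k : ℝ) < n := by linarith
    norm_cast at h1 h2
    omega

/-! ### Quotients by antichains and by intervals -/

theorem exists_isQuotient_of_isGeometricToricAntichain (hP : P.IsOver G) {A : Set V}
    (hA : P.IsGeometricToricAntichain A) : ∃ Q, IsQuotient G P (blockPartition A) Q := by
  obtain ⟨x₀, h₀, hc⟩ := IsToricChamber.exists_eq_image_alcove hP
  obtain ⟨y, hy, hyc⟩ := hA
  rw [hc] at hyc
  obtain ⟨x, hx, rfl⟩ := hyc
  exact exists_isQuotient_of_mem_closedAlcove hP (self_mem_alcove h₀) hc _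
    (alcove_subset_closedAlcove hx) hy fun a b hab _ => hx a b hab

/-- Covers the degenerate intervals: the empty one and `[i, i]`. -/
theorem isGeometricToricAntichain_of_subsingleton (P : ToricPoset V) {A : Set V}
    (hA : A.Subsingleton) : P.IsGeometricToricAntichain A := by
  obtain ⟨G, x, hx, hc⟩ := P.exists_graph
  refine ⟨x, ?_, hc ▸ mem_connectedComponentIn hx⟩
  rintro a b (rfl | ⟨ha, hb⟩)
  · rfl
  · rw [hA ha hb]

theorem exists_isQuotient_toricInterval (hP : P.IsOver G) (i j : V) :
    ∃ Q, IsQuotient G P (blockPartition (P.toricInterval i j)) Q := by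
  by_cases hij : i = j
  · subst hij
    refine exists_isQuotient_of_isGeometricToricAntichain hP
      (P.isGeometricToricAntichain_of_subsingleton (subsingleton_of_subset_singleton (a := i) ?_))
    rintro k ⟨-, h | h | h⟩
    · exact h
    · exact h
    · exact absurd h.1 (by simp)
  by_cases hC : ∃ C, P.IsToricChain C ∧ i ∈ C ∧ j ∈ C
  swap
  · exact exists_isQuotient_of_isGeometricToricAntichain hP
      (P.isGeometricToricAntichain_of_subsingleton fun k hk => absurd hk.1 hC)
  obtain ⟨x₀, h₀, hc⟩ := IsToricChamber.exists_eq_image_alcove hP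
  have h₀' := self_mem_alcove h₀
  have hmem : ∀ z ∈ alcove G x₀, torusProj z ∈ P.chamber := fun z hz => hc ▸ ⟨z, hz, rfl⟩
  obtain ⟨m, hm⟩ : ∃ m : ℤ, ∀ z ∈ alcove G x₀, (m : ℝ) < z j - z i ∧ z j - z i < m + 1 := by
    refine exists_int_between_of_forall_ne h₀' fun z hz h => ?_
    obtain ⟨C, hC, hi, hj⟩ := hC
    exact hC.ne_of_mem_chamber hj hi (Ne.symm hij) (hmem z hz) (unitAddCircle_coe_eq_iff.2 h)
  set F : Set (V → ℝ) := closedAlcove G x₀ ∩ {x | x j - x i = m}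
  -- At `q` the arc from `i` to `j` starts at `q i` and has length `q j - q i - m`; collapsing it
  -- sends `i` to this length and `j` to this length plus `m`.
  have hcollapse : ∀ q ∈ alcove G x₀,
      (fun v => collapseArc (q i) (q j - q i - m) (q v)) ∈ F := by
    intro q hq
    obtain ⟨h1, h2⟩ := hm q hq
    refine ⟨collapseArc_comp_mem_closedAlcove _ (by linarith) hq, ?_⟩
    have e := collapseArc_add_intCast (q i) (q j - q i - m) (q i + (q j - q i - m)) m
    rw [collapseArc_right (by linarith) (by linarith),
      show q i + (q j - q i - m) + m = q j by ring] at e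
    simp only [mem_ofPred_eq, e, collapseArc_self (show 0 ≤ q j - q i - m by linarith)]
    ring
  have hFconv : Convex ℝ F := by
    refine convex_closedAlcove.inter fun x hx y hy s t _ _ hst => ?_
    simp only [mem_ofPred_eq, Pi.add_apply, Pi.smul_apply, smul_eq_mul] at hx hy ⊢
    obtain rfl : t = 1 - s := by linarith
    linear_combination s * hx + (1 - s) * hy
  have harc : ∀ a ∉ P.toricInterval i j, ∃ q ∈ alcove G x₀,
      q j - q i - m < Int.fract (q a - q i) := by
    intro a ha
    by_contra! hcon
    have hai : a ≠ i := fun h => ha ⟨hC, Or.inl h⟩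
    have haj : a ≠ j := fun h => ha ⟨hC, Or.inr (Or.inl h)⟩
    refine ha ⟨hC, Or.inr (Or.inr (restrictsTo_of_forall_mem_arc hc hij hai haj hm
      fun z hz => ⟨-⌊z a - z i⌋, ?_⟩))⟩
    have h1 := hcon z hz
    have h2 := Int.fract_nonneg (z a - z i)
    rw [Int.fract] at h1 h2
    push_cast
    constructor <;> linarith
  set E : Set (V × V) := {e | G.Adj e.1 e.2 ∧ ¬ blockPartition (P.toricInterval i j) e.1 e.2}
  have hEfin : E.Finite := E.toFinite
  obtain ⟨x, hxF, hxE⟩ := exists_mem_forall_strict hFconv ⟨_, hcollapse x₀ h₀'⟩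
    inter_subset_left hEfin.toFinset (fun e he => (hEfin.mem_toFinset.1 he).1) (by
      intro e he
      obtain ⟨hadj, hblock⟩ := hEfin.mem_toFinset.1 he
      have : e.1 ∉ P.toricInterval i j ∨ e.2 ∉ P.toricInterval i j := by
        by_contra! h
        exact hblock (Or.inr h)
      obtain ⟨q, hq, h⟩ : ∃ q ∈ alcove G x₀, q j - q i - m < Int.fract (q e.1 - q i) ∨
          q j - q i - m < Int.fract (q e.2 - q i) := by
        rcases this with h | h
        · obtain ⟨q, hq, h⟩ := harc _ h
          exact ⟨q, hq, Or.inl h⟩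
        · obtain ⟨q, hq, h⟩ := harc _ h
          exact ⟨q, hq, Or.inr h⟩
      exact ⟨_, hcollapse q hq, collapseArc_comp_strict (by linarith [hm q hq]) hq hadj h⟩)
  -- For `k` strictly inside, `x_i ≤ x_k - n ≤ x_j - m` passes from the alcove to its closure with
  -- fixed integers, and on `F` the two ends are equal.
  have hS : ∀ k ∈ P.toricInterval i j, torusProj x k = torusProj x i := by
    have hxij : x j - x i = m := hxF.2
    rintro k ⟨-, rfl | rfl | hk⟩
    · rfl
    · exact unitAddCircle_coe_eq_iff.2 ⟨m, hxij⟩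
    have hord := fun z hz => exists_isRotated_pairwise_repIco_iff.1 (hk.2 _ (hmem z hz))
    obtain ⟨n, hn⟩ := exists_int_between_of_forall_ne h₀' (a := k) (b := i) fun z hz ⟨r, hr⟩ => by
      obtain ⟨s, t, h1, h2, h3⟩ := hord z hz
      have h4 : (0 : ℝ) < (r + s : ℤ) := by push_cast; linarith
      have h5 : ((r + s : ℤ) : ℝ) < 1 := by push_cast; linarith
      norm_cast at h4 h5
      omega
    have h1 : x i - x k ≤ -n := sub_le_of_mem_closedAlcove h₀'
      (fun z hz => by linarith [hn z hz]) hxF.1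
    have h2 : x k - x j ≤ n - m := sub_le_of_mem_closedAlcove h₀' (fun z hz => by
      obtain ⟨s, t, h1, h2, h3⟩ := hord z hz
      obtain ⟨h4, h5⟩ := hn z hz
      obtain ⟨h6, h7⟩ := hm z hz
      have h8 : (0 : ℝ) < (n + s + 1 : ℤ) := by push_cast; linarith
      have h9 : ((n + s : ℤ) : ℝ) < 1 := by push_cast; linarith
      have h10 : (0 : ℝ) < (m + t + 1 : ℤ) := by push_cast; linarith
      have h11 : ((m + t : ℤ) : ℝ) < 1 := by push_cast; linarith
      norm_cast at h8 h9 h10 h11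
      have e1 : (s : ℝ) = -n := by exact_mod_cast (by omega : s = -n)
      have e2 : (t : ℝ) = -m := by exact_mod_cast (by omega : t = -m)
      linarith) hxF.1
    exact unitAddCircle_coe_eq_iff.2 ⟨n, by linarith⟩
  refine exists_isQuotient_of_mem_closedAlcove hP h₀' hc _ hxF.1 ?_
    fun a b hab hblock => hxE (a, b) (hEfin.mem_toFinset.2 ⟨hab, hblock⟩)
  rintro a b (rfl | ⟨ha, hb⟩)
  · rfl
  · rw [hS a ha, hS b hb]

end ToricPoset

theorem mainTheorem11 {V : Type u} [Finite V] (G : SimpleGraph V) (P : ToricPoset V)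
    (hP : P.IsOver G) :
    (∀ i j : V, ∃ Q : ToricPoset (Quotient (blockPartition (P.toricInterval i j))),
      ToricPoset.IsQuotient G P (blockPartition (P.toricInterval i j)) Q ∧
      IsToricMorphism P Q (Quotient.mk (blockPartition (P.toricInterval i j)))) ∧
    (∀ A : Set V, P.IsGeometricToricAntichain A →
      ∃ Q : ToricPoset (Quotient (blockPartition A)),
        ToricPoset.IsQuotient G P (blockPartition A) Q ∧
        IsToricMorphism P Q (Quotient.mk (blockPartition A))) := by
  refine ⟨fun i j => ?_, fun A hA => ?_⟩
  · obtain ⟨Q, hQ⟩ := ToricPoset.exists_isQuotient_toricInterval hP i j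
    exact ⟨Q, hQ, .quotient G P _ Q hQ⟩
  · obtain ⟨Q, hQ⟩ := ToricPoset.exists_isQuotient_of_isGeometricToricAntichain hP hA
    exact ⟨Q, hQ, .quotient G P _ Q hQ⟩
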